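/- Let $\mathcal V$ be a finite ground set, let $\mathcal M=(\mathcal V,\mathcal I)$ be a matroid of rank $r$, and let $F:2^{\mathcal V}\to\mathbb R$ be non-decreasing with $F(\emptyset)\ge 0$. Write $\rho_\Omega(S)=F(S\cup\Omega)-F(S)$ and $\rho_v=\rho_{\{v\}}$. For $\gamma\in[0,1]$, call $F$ $\gamma$-weakly submodular if $$\sum_{v\in\Omega\setminus S}\rho_v(S)\ \ge\ \gamma\,\rho_\Omega(S)\qquad\text{for all }\Omega,S\subseteq\mathcal V .$$ The greedy algorithm starts with $S=U=\emptyset$; while $U\ne\mathcal V$ it picks $v\in\mathcal V\setminus U$ maximizing $\rho_v(S)$ (ties broken arbitrarily), adds $v$ to $U$, and also adds $v$ to $S$ if $S\cup\{v\}\in\mathcal I$. It returns the final $S$. Let $\mathrm{OPT}=\max_{T\in\mathcal I}F(T)$. Then the greedy algorithm has approximation factor $\Omega(\gamma^2)$ if $\gamma r=O(1)$, and $\Omega(\gamma\sqrt\gamma/\sqrt r)$ if $\gamma r=\Omega(1)$. That is: 1. for every $C>0$ there is a constant $c>0$, depending only on $C$, such that for all $\mathcal V,\mathcal M,r,\gamma$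 and all $\gamma$-weakly submodular $F$ as above with $\gamma r\le C$, every output $S$ of the greedy algorithm satisfies $F(S)\ge c\,\gamma^2\,\mathrm{OPT}$; 2. for every $b>0$ there is a constant $c>0$, depending only on $b$, such that for all $\mathcal V,\mathcal M,r,\gamma$ and all $\gamma$-weakly submodular $F$ as above with $\gamma r\ge b$, every output $S$ of the greedy algorithm satisfies $F(S)\ge c\,\dfrac{\gamma\sqrt\gamma}{\sqrt r}\,\mathrm{OPT}$. -/

import Mathlib

universe u

/-- The marginal gain `ρ_Ω(S) = F(S ∪ Ω) - F(S)`. -/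
def marginalGain {V : Type u} [DecidableEq V] (F : Finset V → ℝ) (Ω S : Finset V) : ℝ :=
  F (S ∪ Ω) - F S

/-- `F` is `γ`-weakly submodular: `∑_{v ∈ Ω \ S} ρ_v(S) ≥ γ ρ_Ω(S)` for all `Ω, S ⊆ V`. -/
def IsWeaklySubmodular {V : Type u} [DecidableEq V] (γ : ℝ) (F : Finset V → ℝ) : Prop :=
  ∀ Ω S : Finset V, γ * marginalGain F Ω S ≤ ∑ v ∈ Ω \ S, marginalGain F {v} S

/-- `IsGreedyChoice F S U v`: the element `v` has not been considered yet, and it maximizes the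
marginal gain `ρ_v(S)` among all such elements. -/
def IsGreedyChoice {V : Type u} [DecidableEq V] (F : Finset V → ℝ) (S U : Finset V) (v : V) :
    Prop :=
  v ∉ U ∧ ∀ w, w ∉ U → marginalGain F {w} S ≤ marginalGain F {v} S

/-- The reachable states of the greedy algorithm for maximizing `F` over the independent sets of
`M`: `GreedyState M F S U` says that some run (ties being broken arbitrarily) reaches a moment at
which `S` is the set of selected items and `U` is the set of items considered so far. -/
inductive GreedyState {V : Type u} [DecidableEq V] (M : Matroid V) (F : Finset V → ℝ) :
    Finset V → Finset V → Prop
  | start : GreedyState M F ∅ ∅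
  | select {S U : Finset V} {v : V} (h : GreedyState M F S U) (hv : IsGreedyChoice F S U v)
      (hI : M.Indep (↑(insert v S) : Set V)) : GreedyState M F (insert v S) (insert v U)
  | discard {S U : Finset V} {v : V} (h : GreedyState M F S U) (hv : IsGreedyChoice F S U v)
      (hI : ¬ M.Indep (↑(insert v S) : Set V)) : GreedyState M F S (insert v U)

/-- `S` is a possible output of the greedy algorithm: the set of selected items once the whole
ground set has been considered. -/
def IsGreedyOutput {V : Type u} [Fintype V] [DecidableEq V] (M : Matroid V) (F : Finset V → ℝ)
    (S : Finset V) : Prop :=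
  GreedyState M F S Finset.univ

/-- `opt` is the maximum of `F` over the independent sets of `M`. -/
def IsOptimalValue {V : Type u} (M : Matroid V) (F : Finset V → ℝ) (opt : ℝ) : Prop :=
  IsGreatest (F '' {T : Finset V | M.Indep (↑T : Set V)}) opt

/-- The greedy algorithm has approximation factor (at least) `β` on the instance `(M, F)`:
whatever the tie-breaking, its output `S` satisfies `F(S) ≥ β · OPT`. -/
def GreedyHasApproxFactor {V : Type u} [Fintype V] [DecidableEq V] (M : Matroid V)
    (F : Finset V → ℝ) (β : ℝ) : Prop :=
  ∀ S : Finset V, IsGreedyOutput M F S → ∀ opt : ℝ, IsOptimalValue M F opt → β * opt ≤ F S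

/-! Let S_i be the first i selections and g_i the gain of the next one. Weak submodularity at S_i
bounds γ(F(T) − F(S)) by the gains of the elements t of T over S_i. Those outside the closure of S_i
gain at most g_i each. Those inside are matched injectively to positions j < i with t outside the
closure of S_j (Hall, `Matroid.Indep.exists_injective_prefix`); a second use of weak submodularity,
at S_j, bounds γ times such a gain by (i+1)g_j (`IsGreedyChain.mul_marginalGain_le`). Summing over i
< k telescopes to kγ²(F(T) − F(S)) ≤ (k² + γr)(F(S) − F(∅)). Take k = 1 if γr is bounded above, k =
⌈√(γr)⌉ if it is bounded below. -/

/-- The first `i` elements of the sequence `s`. -/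
def prefixSet {V : Type u} [DecidableEq V] (s : ℕ → V) (i : ℕ) : Finset V :=
  (Finset.range i).image s

/-- The first `n` elements of `s` are successive greedy selections: each one lies outside the
closure of its predecessors and has the largest marginal gain among all such elements. -/
def IsGreedyChain {V : Type u} [DecidableEq V] (M : Matroid V) (F : Finset V → ℝ) (s : ℕ → V)
    (n : ℕ) : Prop :=
  ∀ i < n, s i ∉ M.closure (prefixSet s i : Set V) ∧
    ∀ t, t ∉ M.closure (prefixSet s i : Set V) →
      marginalGain F {t} (prefixSet s i) ≤ marginalGain F {s i} (prefixSet s i)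

section

variable {V : Type u} [DecidableEq V] {M : Matroid V} {F : Finset V → ℝ} {s : ℕ → V} {n : ℕ}

theorem prefixSet_zero (s : ℕ → V) : prefixSet s 0 = ∅ := by
  simp [prefixSet]

theorem prefixSet_succ (s : ℕ → V) (i : ℕ) : prefixSet s (i + 1) = insert (s i) (prefixSet s i) := by
  simp [prefixSet, Finset.range_add_one]

theorem prefixSet_mono (s : ℕ → V) : Monotone (prefixSet s) := fun _ _ h =>
  Finset.image_subset_image (Finset.range_subset_range.2 h)

theorem prefixSet_update (s : ℕ → V) (v : V) {i n : ℕ} (h : i ≤ n) :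
    prefixSet (Function.update s n v) i = prefixSet s i := by
  refine Finset.image_congr fun j hj => ?_
  have : j < i := by simpa using hj
  exact Function.update_of_ne (by omega) _ _

theorem card_prefixSet_le (s : ℕ → V) (i : ℕ) : (prefixSet s i).card ≤ i :=
  Finset.card_image_le.trans (Finset.card_range i).le

theorem marginalGain_selection (F : Finset V → ℝ) (s : ℕ → V) (i : ℕ) :
    marginalGain F {s i} (prefixSet s i) = F (prefixSet s (i + 1)) - F (prefixSet s i) := by
  rw [marginalGain, prefixSet_succ, Finset.union_comm, Finset.insert_eq]

/-! ### Greedy runs as chains of selections -/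

theorem IsGreedyChain.extend (h : IsGreedyChain M F s n) {v : V}
    (hv : v ∉ M.closure (prefixSet s n : Set V))
    (hmax : ∀ t, t ∉ M.closure (prefixSet s n : Set V) →
      marginalGain F {t} (prefixSet s n) ≤ marginalGain F {v} (prefixSet s n)) :
    IsGreedyChain M F (Function.update s n v) (n + 1) := by
  intro i hi
  rcases Nat.lt_succ_iff_lt_or_eq.1 hi with hi | rfl
  · rw [prefixSet_update s v hi.le, Function.update_of_ne hi.ne]
    exact h i hi
  · rw [prefixSet_update s v le_rfl, Function.update_self]
    exact ⟨hv, hmax⟩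

theorem GreedyState.subset {S U : Finset V} (h : GreedyState M F S U) : S ⊆ U := by
  induction h with
  | start => exact subset_rfl
  | select _ _ _ ih => exact Finset.insert_subset_insert _ ih
  | discard _ _ _ ih => exact ih.trans (Finset.subset_insert _ _)

/-- A greedy state arises from a greedy chain whose closure contains the considered elements. -/
theorem GreedyState.exists_chain [Nonempty V] (hE : M.E = Set.univ) {S U : Finset V}
    (h : GreedyState M F S U) :
    M.Indep (S : Set V) ∧ (U : Set V) ⊆ M.closure (S : Set V) ∧
      ∃ s n, prefixSet s n = S ∧ IsGreedyChain M F s n ∧ S.card = n := by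
  induction h with
  | start =>
    exact ⟨by simp, by simp, fun _ => Classical.arbitrary V, 0, by simp [prefixSet],
      fun i hi => absurd hi (Nat.not_lt_zero i), rfl⟩
  | @select S U v h hv hI ih =>
    obtain ⟨hS, hU, s, n, rfl, hs, hc⟩ := ih
    have hvS : v ∉ prefixSet s n := by
      intro hmem
      exact hv.1 (h.subset hmem)
    have hcl : v ∉ M.closure (prefixSet s n : Set V) := by
      rw [hS.notMem_closure_iff (by rw [hE]; trivial)]
      exact ⟨by simpa using hI, by simpa using hvS⟩
    refine ⟨hI, ?_, Function.update s n v, n + 1, ?_, hs.extend hcl fun t ht => ?_, ?_⟩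
    · have h1 : M.closure (prefixSet s n : Set V) ⊆ M.closure (↑(insert v (prefixSet s n)) : Set V) :=
        M.closure_subset_closure (by simp)
      have h2 : (↑(insert v (prefixSet s n)) : Set V) ⊆ M.closure (↑(insert v (prefixSet s n)) : Set V) :=
        M.subset_closure _ (by rw [hE]; exact Set.subset_univ _)
      rw [Finset.coe_insert v U]
      exact Set.insert_subset (h2 (by simp)) (hU.trans h1)
    · rw [prefixSet_succ, prefixSet_update s v le_rfl, Function.update_self]
    -- Considered elements lie in the closure, so a maximizer over the unconsidered ones also beats
    -- everything outside the closure.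
    · exact hv.2 t fun htU => ht (hU htU)
    · rw [Finset.card_insert_of_notMem hvS, hc]
  | @discard S U v h hv hI ih =>
    obtain ⟨hS, hU, hex⟩ := ih
    refine ⟨hS, ?_, hex⟩
    rw [Finset.coe_insert]
    refine Set.insert_subset ?_ hU
    rw [hS.mem_closure_iff_of_notMem (fun hmem => hv.1 (h.subset hmem)),
      ← M.not_indep_iff (by rw [hE]; exact Set.subset_univ _)]
    simpa using hI

/-! ### Matching an independent set to positions -/

/-- A set independent in `M` and contained in the closure of the first `i` elements of a sequence
can be matched injectively into those positions, each element lying outside the closure of the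
elements preceding its position. -/
theorem Matroid.Indep.exists_injective_prefix {A : Finset V} (hA : M.Indep (A : Set V)) {i : ℕ}
    (hAi : (A : Set V) ⊆ M.closure (prefixSet s i : Set V)) :
    ∃ f : A → ℕ, Function.Injective f ∧
      ∀ t, f t < i ∧ (t : V) ∉ M.closure (prefixSet s (f t) : Set V) := by
  classical
  let slots : A → Finset ℕ := fun t =>
    (Finset.range i).filter fun j => (t : V) ∉ M.closure (prefixSet s j : Set V)
  obtain ⟨f, hf, hmem⟩ := (Finset.all_card_le_biUnion_card_iff_exists_injective slots).1 (by
    intro X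
    have hex : ∃ m, ∀ t ∈ X, (t : V) ∈ M.closure (prefixSet s m : Set V) :=
      ⟨i, fun t _ => hAi t.2⟩
    -- Hall's condition: every position before the least m whose prefix spans X is a slot of some
    -- element of X, and |X| ≤ m by rank.
    set m := Nat.find hex
    have hmi : m ≤ i := Nat.find_min' hex fun t _ => hAi t.2
    have hsub : Finset.range m ⊆ X.biUnion slots := by
      intro j hj
      have hj : j < m := Finset.mem_range.1 hj
      have := Nat.find_min hex hj
      push Not at this
      obtain ⟨t, ht, htj⟩ := this
      exact Finset.mem_biUnion.2 ⟨t, ht, by simp [slots, htj, hj.trans_le hmi]⟩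
    have hX : M.Indep (X.map (Function.Embedding.subtype _) : Set V) :=
      hA.subset fun t ht => by
        obtain ⟨x, -, rfl⟩ := Finset.mem_map.1 (Finset.mem_coe.1 ht)
        exact x.2
    have hle : ((X.card : ℕ) : ℕ∞) ≤ m := by
      calc ((X.card : ℕ) : ℕ∞) = (X.map (Function.Embedding.subtype _) : Set V).encard := by
            rw [Set.encard_coe_eq_coe_finsetCard, Finset.card_map]
        _ ≤ M.eRk (M.closure (prefixSet s m : Set V)) := by
            refine hX.encard_le_eRk_of_subset fun t ht => ?_
            obtain ⟨x, hx, rfl⟩ := Finset.mem_map.1 (Finset.mem_coe.1 ht)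
            exact Nat.find_spec hex x hx
        _ ≤ (prefixSet s m : Set V).encard := by
            rw [M.eRk_closure_eq]
            exact M.eRk_le_encard _
        _ ≤ m := by
            rw [Set.encard_coe_eq_coe_finsetCard]
            exact_mod_cast card_prefixSet_le s m
    have hle : X.card ≤ m := by exact_mod_cast hle
    simpa using hle.trans ((Finset.card_range m).symm.le.trans (Finset.card_le_card hsub)))
  exact ⟨f, hf, fun t => by simpa [slots] using hmem t⟩

/-! ### Marginal gains and averaging -/

/-- The marginal gain of an element outside the closure of the first `j` selections, taken after
`i ≥ j` selections, is controlled by the gain of the greedy selection at position `j`. -/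
theorem IsGreedyChain.mul_marginalGain_le (hs : IsGreedyChain M F s n) (hF : Monotone F) {γ : ℝ}
    (hγ : 0 ≤ γ) (hw : IsWeaklySubmodular γ F) {i j : ℕ} (hi : i < n) (hji : j < i) {t : V}
    (ht : t ∉ M.closure (prefixSet s j : Set V)) :
    γ * marginalGain F {t} (prefixSet s i) ≤
      (i + 1) * (F (prefixSet s (j + 1)) - F (prefixSet s j)) := by
  have hsub : prefixSet s j ⊆ insert t (prefixSet s i) :=
    (prefixSet_mono s hji.le).trans (Finset.subset_insert _ _)
  have hgain : 0 ≤ F (prefixSet s (j + 1)) - F (prefixSet s j) :=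
    sub_nonneg.2 (hF (prefixSet_mono s j.le_succ))
  have hcard : ((insert t (prefixSet s i) \ prefixSet s j).card : ℝ) ≤ i + 1 := by
    have h1 : (insert t (prefixSet s i) \ prefixSet s j).card ≤ i + 1 :=
      (Finset.card_le_card Finset.sdiff_subset).trans
        ((Finset.card_insert_le _ _).trans (Nat.succ_le_succ (card_prefixSet_le s i)))
    exact_mod_cast h1
  calc γ * marginalGain F {t} (prefixSet s i)
      ≤ γ * marginalGain F (insert t (prefixSet s i)) (prefixSet s j) := by
        refine mul_le_mul_of_nonneg_left ?_ hγ
        rw [marginalGain, marginalGain, Finset.union_eq_right.2 hsub, Finset.union_comm,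
          ← Finset.insert_eq]
        exact sub_le_sub_left (hF (prefixSet_mono s hji.le)) _
    _ ≤ ∑ v ∈ insert t (prefixSet s i) \ prefixSet s j, marginalGain F {v} (prefixSet s j) :=
        hw _ _
    _ ≤ ∑ _v ∈ insert t (prefixSet s i) \ prefixSet s j,
          (F (prefixSet s (j + 1)) - F (prefixSet s j)) := by
        refine Finset.sum_le_sum fun v hv => ?_
        rw [← marginalGain_selection]
        refine (hs j (hji.trans hi)).2 v ?_
        obtain ⟨hv, hvj⟩ := Finset.mem_sdiff.1 hv
        rcases Finset.mem_insert.1 hv with rfl | hv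
        · exact ht
        · obtain ⟨k, hk, rfl⟩ := Finset.mem_image.1 hv
          have hki : k < i := Finset.mem_range.1 hk
          have hjk : j ≤ k := by
            by_contra hlt
            exact hvj (Finset.mem_image_of_mem s (Finset.mem_range.2 (not_le.1 hlt)))
          -- A later selection was still outside the closure at time j, hence a competitor of `s j`.
          exact fun hmem => (hs k (hki.trans hi)).1
            (M.closure_subset_closure (Finset.coe_subset.2 (prefixSet_mono s hjk)) hmem)
    _ ≤ (i + 1) * (F (prefixSet s (j + 1)) - F (prefixSet s j)) := by
        rw [Finset.sum_const, nsmul_eq_mul]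
        exact mul_le_mul_of_nonneg_right hcard hgain

theorem sum_prefix_gain (F : Finset V → ℝ) (s : ℕ → V) (i : ℕ) :
    ∑ j ∈ Finset.range i, (F (prefixSet s (j + 1)) - F (prefixSet s j)) =
      F (prefixSet s i) - F ∅ := by
  rw [Finset.sum_range_sub fun j => F (prefixSet s j), prefixSet_zero]

/-- The comparison of a greedy chain with an independent set, at a single position. -/
theorem IsGreedyChain.sq_mul_sub_le (hs : IsGreedyChain M F s n) (hF : Monotone F) {γ : ℝ}
    (hγ : 0 ≤ γ) (hw : IsWeaklySubmodular γ F) {T : Finset V} (hT : M.Indep (T : Set V)) {r : ℕ}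
    (hr : T.card ≤ r) {i : ℕ} (hi : i < n) :
    γ ^ 2 * (F T - F (prefixSet s n)) ≤
      (i + 1) * (F (prefixSet s i) - F ∅) +
        γ * r * (F (prefixSet s (i + 1)) - F (prefixSet s i)) := by
  classical
  set g : ℕ → ℝ := fun j => F (prefixSet s (j + 1)) - F (prefixSet s j)
  have hg0 : ∀ j, 0 ≤ g j := fun j => sub_nonneg.2 (hF (prefixSet_mono s j.le_succ))
  set A := T.filter fun t => t ∈ M.closure (prefixSet s i : Set V)
  set B := T.filter fun t => ¬ t ∈ M.closure (prefixSet s i : Set V)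
  have hmarg : ∀ t, 0 ≤ marginalGain F {t} (prefixSet s i) := fun t =>
    sub_nonneg.2 (hF Finset.subset_union_left)
  have hA : γ * ∑ t ∈ A, marginalGain F {t} (prefixSet s i) ≤
      (i + 1) * (F (prefixSet s i) - F ∅) := by
    obtain ⟨f, hf, hfi⟩ := (hT.subset (Finset.coe_subset.2 (Finset.filter_subset _ T)) :
      M.Indep (A : Set V)).exists_injective_prefix (s := s) (i := i)
        fun t ht => (Finset.mem_filter.1 (Finset.mem_coe.1 ht)).2
    calc γ * ∑ t ∈ A, marginalGain F {t} (prefixSet s i)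
        = ∑ t : A, γ * marginalGain F {(t : V)} (prefixSet s i) := by
          rw [← Finset.sum_coe_sort, Finset.mul_sum]
      _ ≤ ∑ t : A, (i + 1) * g (f t) := Finset.sum_le_sum fun t _ =>
          hs.mul_marginalGain_le hF hγ hw hi (hfi t).1 (hfi t).2
      _ = (i + 1) * ∑ j ∈ Finset.univ.image f, g j := by
          rw [← Finset.mul_sum, Finset.sum_image hf.injOn]
      _ ≤ (i + 1) * ∑ j ∈ Finset.range i, g j := by
          refine mul_le_mul_of_nonneg_left ?_ (by positivity)
          refine Finset.sum_le_sum_of_subset_of_nonneg (fun j hj => ?_) fun j _ _ => hg0 j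
          obtain ⟨t, -, rfl⟩ := Finset.mem_image.1 hj
          exact Finset.mem_range.2 (hfi t).1
      _ = _ := by rw [sum_prefix_gain]
  have hB : ∑ t ∈ B, marginalGain F {t} (prefixSet s i) ≤ r * g i := by
    calc ∑ t ∈ B, marginalGain F {t} (prefixSet s i) ≤ ∑ _t ∈ B, g i := by
          refine Finset.sum_le_sum fun t ht => ?_
          exact ((hs i hi).2 t (Finset.mem_filter.1 ht).2).trans_eq (marginalGain_selection F s i)
      _ ≤ r * g i := by
          rw [Finset.sum_const, nsmul_eq_mul]
          refine mul_le_mul_of_nonneg_right ?_ (hg0 i)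
          exact_mod_cast (Finset.card_filter_le _ _).trans hr
  have hweak : γ * (F T - F (prefixSet s n)) ≤
      ∑ t ∈ A, marginalGain F {t} (prefixSet s i) +
        ∑ t ∈ B, marginalGain F {t} (prefixSet s i) := by
    -- Monotonicity: F(T) ≤ F(S_i ∪ T) and F(S_i) ≤ F(S_n).
    calc γ * (F T - F (prefixSet s n)) ≤ γ * marginalGain F T (prefixSet s i) :=
          mul_le_mul_of_nonneg_left
            (sub_le_sub (hF Finset.subset_union_right) (hF (prefixSet_mono s hi.le))) hγ
      _ ≤ ∑ t ∈ T \ prefixSet s i, marginalGain F {t} (prefixSet s i) := hw _ _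
      _ ≤ ∑ t ∈ T, marginalGain F {t} (prefixSet s i) :=
          Finset.sum_le_sum_of_subset_of_nonneg Finset.sdiff_subset fun t _ _ => hmarg t
      _ = _ := (Finset.sum_filter_add_sum_filter_not _ _ _).symm
  have h1 := mul_le_mul_of_nonneg_left hweak hγ
  have h2 := mul_le_mul_of_nonneg_left hB hγ
  calc γ ^ 2 * (F T - F (prefixSet s n)) = γ * (γ * (F T - F (prefixSet s n))) := by ring
    _ ≤ _ := h1
    _ ≤ (i + 1) * (F (prefixSet s i) - F ∅) + γ * (r * g i) := by rw [mul_add]; linarith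
    _ = _ := by rw [mul_assoc]

/-- The comparison of a greedy chain with an independent set, averaged over the first `k`
positions. -/
theorem IsGreedyChain.mul_sub_le (hs : IsGreedyChain M F s n) (hF : Monotone F) {γ : ℝ}
    (hγ : 0 ≤ γ) (hw : IsWeaklySubmodular γ F) {T : Finset V} (hT : M.Indep (T : Set V)) {r : ℕ}
    (hr : T.card ≤ r) {k : ℕ} (hk : k ≤ n) :
    k * (γ ^ 2 * (F T - F (prefixSet s n))) ≤
      (k ^ 2 + γ * r) * (F (prefixSet s n) - F ∅) := by
  have hle : ∀ i ≤ n, F (prefixSet s i) - F ∅ ≤ F (prefixSet s n) - F ∅ := fun i hi =>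
    sub_le_sub_right (hF (prefixSet_mono s hi)) _
  have hA : 0 ≤ F (prefixSet s n) - F ∅ := sub_nonneg.2 (hF (Finset.empty_subset _))
  calc k * (γ ^ 2 * (F T - F (prefixSet s n)))
      = ∑ _i ∈ Finset.range k, γ ^ 2 * (F T - F (prefixSet s n)) := by simp
    _ ≤ ∑ i ∈ Finset.range k, (k * (F (prefixSet s n) - F ∅) +
          γ * r * (F (prefixSet s (i + 1)) - F (prefixSet s i))) := by
        refine Finset.sum_le_sum fun i hi => ?_
        have hik : i < k := Finset.mem_range.1 hi
        refine (hs.sq_mul_sub_le hF hγ hw hT hr (hik.trans_le hk)).trans ?_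
        refine add_le_add_left (mul_le_mul ?_ (hle i (hik.le.trans hk))
          (sub_nonneg.2 (hF (Finset.empty_subset _))) k.cast_nonneg) _
        exact_mod_cast hik
    _ = k * (k * (F (prefixSet s n) - F ∅)) + γ * r * (F (prefixSet s k) - F ∅) := by
        rw [Finset.sum_add_distrib, ← Finset.mul_sum, ← Finset.mul_sum, sum_prefix_gain,
          Finset.sum_const, Finset.card_range, nsmul_eq_mul]
    _ ≤ k * (k * (F (prefixSet s n) - F ∅)) + γ * r * (F (prefixSet s n) - F ∅) := by
        have := hle k hk
        gcongr
    _ = _ := by ring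

/-- The comparison of a greedy output with an independent set, in terms of a free parameter `k`
that is at most the rank. -/
theorem IsGreedyOutput.mul_sub_le [Fintype V] (hE : M.E = Set.univ) {r : ℕ}
    (hr : M.eRank = (r : ℕ∞)) (hF : Monotone F) {γ : ℝ} (hγ : 0 ≤ γ)
    (hw : IsWeaklySubmodular γ F) {S T : Finset V} (hS : IsGreedyOutput M F S)
    (hT : M.Indep (T : Set V)) {k : ℕ} (hk : k ≤ r) :
    k * (γ ^ 2 * (F T - F S)) ≤ (k ^ 2 + γ * r) * (F S - F ∅) := by
  rcases isEmpty_or_nonempty V with hV | hV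
  · rw [Subsingleton.elim T ∅, Subsingleton.elim S ∅]
    simp
  obtain ⟨hSI, hcl, s, n, rfl, hs, hc⟩ := GreedyState.exists_chain hE hS
  -- The output is independent and spans the ground set, so every k ≤ r is an admissible number of
  -- positions.
  have hn : n = r := by
    have h1 : M.eRk (prefixSet s n : Set V) = M.eRank := by
      rw [← M.eRk_closure_eq]
      exact M.eRk_eq_eRank (by rw [hE]; simpa using hcl)
    rw [hSI.eRk_eq_encard, Set.encard_coe_eq_coe_finsetCard, hc, hr] at h1
    exact_mod_cast h1
  have hTr : T.card ≤ r := by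
    have h1 := M.eRk_le_eRank (T : Set V)
    rw [hT.eRk_eq_encard, Set.encard_coe_eq_coe_finsetCard, hr] at h1
    exact_mod_cast h1
  exact hs.mul_sub_le hF hγ hw hT hTr (hk.trans hn.ge)

/-- The additive comparison implies the multiplicative one when `F ∅` is nonnegative. -/
theorem mul_le_of_mul_sub_le {β a x y : ℝ} (hβ : β ≤ 1) (ha : 0 ≤ a)
    (h : β * (y - a) ≤ x - a) : β * y ≤ x := by
  nlinarith [mul_nonneg (sub_nonneg.2 hβ) ha]

end

/-! ### Choice of k and of the constants -/

theorem mainTheorem9 :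
    (∀ C : ℝ, 0 < C → ∃ c : ℝ, 0 < c ∧
      ∀ (V : Type u) [Fintype V] [DecidableEq V] (M : Matroid V) (F : Finset V → ℝ)
        (r : ℕ) (γ : ℝ),
        M.E = Set.univ → M.eRank = (r : ℕ∞) →
        Monotone F → 0 ≤ F ∅ →
        0 ≤ γ → γ ≤ 1 → IsWeaklySubmodular γ F →
        γ * (r : ℝ) ≤ C →
        GreedyHasApproxFactor M F (c * γ ^ 2)) ∧
    (∀ b : ℝ, 0 < b → ∃ c : ℝ, 0 < c ∧
      ∀ (V : Type u) [Fintype V] [DecidableEq V] (M : Matroid V) (F : Finset V → ℝ)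
        (r : ℕ) (γ : ℝ),
        M.E = Set.univ → M.eRank = (r : ℕ∞) →
        Monotone F → 0 ≤ F ∅ →
        0 ≤ γ → γ ≤ 1 → IsWeaklySubmodular γ F →
        b ≤ γ * (r : ℝ) →
        GreedyHasApproxFactor M F (c * (γ * Real.sqrt γ / Real.sqrt (r : ℝ)))) := by
  -- The denominators come from γ² + 1 + γr ≤ 2 + C, and from 2x + 2 ≤ (2 + 2/√b)x for x = √(γr) ≥
  -- √b.
  refine ⟨fun C hC => ⟨1 / (2 + C), by positivity, ?_⟩,
    fun b hb => ⟨1 / (2 + 2 / √b), by positivity, ?_⟩⟩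
  · rintro V _ _ M F r γ hE hr hF hF0 hγ hγ1 hw hγr S hS _ ⟨⟨T, hT, rfl⟩, -⟩
    have hA : 0 ≤ F S - F ∅ := sub_nonneg.2 (hF (Finset.empty_subset _))
    have hγ2 : γ ^ 2 ≤ 1 := pow_le_one₀ hγ hγ1
    have hC2 : 0 < 2 + C := by positivity
    refine mul_le_of_mul_sub_le ?_ hF0 ?_
    · rw [one_div, inv_mul_le_one₀ hC2]
      linarith
    rw [one_div, mul_assoc, inv_mul_le_iff₀ hC2]
    -- In rank 0 the choice k = 1 is not available, but then T = ∅.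
    rcases Nat.eq_zero_or_pos r with rfl | hr0
    · have h1 := M.eRk_le_eRank (T : Set V)
      rw [hT.eRk_eq_encard, hr, Nat.cast_zero, nonpos_iff_eq_zero, Set.encard_eq_zero,
        Finset.coe_eq_empty] at h1
      rw [h1, sub_self, mul_zero]
      positivity
    · have h := hS.mul_sub_le hE hr hF hγ hw hT (k := 1) hr0
      norm_num at h
      have h1 := mul_le_mul_of_nonneg_right hγr hA
      have h2 := mul_le_mul_of_nonneg_right hγ2 hA
      linarith
  · rintro V _ _ M F r γ hE hr hF hF0 hγ hγ1 hw hγr S hS _ ⟨⟨T, hT, rfl⟩, -⟩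
    have hA : 0 ≤ F S - F ∅ := sub_nonneg.2 (hF (Finset.empty_subset _))
    have hγr0 : 0 < γ * r := hb.trans_le hγr
    have hr0 : (0 : ℝ) < r := pos_of_mul_pos_right hγr0 hγ
    have hr1 : (1 : ℝ) ≤ r := by exact_mod_cast Nat.cast_pos.1 hr0
    have hγ0 : 0 < γ := pos_of_mul_pos_left hγr0 hr0.le
    have hsr : 0 < √(r : ℝ) := Real.sqrt_pos.2 hr0
    have hsb : 0 < √b := Real.sqrt_pos.2 hb
    set x := √(γ * r) with hx
    have hx0 : 0 < x := Real.sqrt_pos.2 hγr0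
    have hxx : x * x = γ * r := Real.mul_self_sqrt hγr0.le
    have hbx : √b ≤ x := Real.sqrt_le_sqrt hγr
    have hfactor : γ * √γ / √(r : ℝ) = γ ^ 2 / x := by
      rw [hx, Real.sqrt_mul hγ, div_eq_div_iff hsr.ne' (by positivity)]
      linear_combination γ * √(r : ℝ) * Real.mul_self_sqrt hγ
    have hk1 : 1 ≤ ⌈x⌉₊ := Nat.one_le_ceil_iff.2 hx0
    have hkr : ⌈x⌉₊ ≤ r := by
      refine Nat.ceil_le.2 (Real.sqrt_le_iff.2 ⟨hr0.le, ?_⟩)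
      nlinarith
    have hxk : x ≤ ⌈x⌉₊ := Nat.le_ceil x
    have hkx : (⌈x⌉₊ : ℝ) ≤ x + 1 := (Nat.ceil_lt_add_one hx0.le).le
    have hc : 0 < 2 + 2 / √b := by positivity
    have hmain : γ ^ 2 * (F T - F ∅) ≤ (2 * x + 2) * (F S - F ∅) := by
      have h := hS.mul_sub_le hE hr hF hγ hw hT hkr
      have hk : (1 : ℝ) ≤ ⌈x⌉₊ := by exact_mod_cast hk1
      generalize (⌈x⌉₊ : ℝ) = k at *
      have hk0 : 0 < k := by linarith
      have hγ2 : γ ^ 2 ≤ 1 := pow_le_one₀ hγ hγ1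
      -- γr = x² ≤ kx, since x ≤ k.
      have h1 : k ^ 2 + γ * r ≤ k * (k + x) := by nlinarith
      have h2 : k * (γ ^ 2 * (F T - F S)) ≤ k * ((k + x) * (F S - F ∅)) := by
        rw [← mul_assoc k (k + x)]
        exact h.trans (mul_le_mul_of_nonneg_right h1 hA)
      have h3 := le_of_mul_le_mul_left h2 hk0
      -- The γ² pays for replacing F(S) by F(∅) on the left; then k ≤ x + 1 and γ² ≤ 1.
      have h4 : (k + x + γ ^ 2) * (F S - F ∅) ≤ (2 * x + 2) * (F S - F ∅) :=
        mul_le_mul_of_nonneg_right (by linarith) hA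
      linarith
    refine mul_le_of_mul_sub_le ?_ hF0 ?_
    · rw [one_div, inv_mul_le_iff₀ hc]
      have h1 : γ * √γ ≤ 1 := mul_le_one₀ hγ1 (Real.sqrt_nonneg _) (Real.sqrt_le_one.2 hγ1)
      have h2 : γ * √γ / √(r : ℝ) ≤ 1 :=
        (div_le_one hsr).2 (h1.trans (Real.one_le_sqrt.2 hr1))
      have h3 : 0 < 2 / √b := by positivity
      linarith
    · rw [hfactor, one_div, mul_assoc, inv_mul_le_iff₀ hc, div_mul_eq_mul_div,
        div_le_iff₀ hx0]
      refine hmain.trans ?_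
      have h1 : 2 ≤ 2 / √b * x := by
        rw [div_mul_eq_mul_div, le_div_iff₀ hsb]
        linarith
      have h2 := mul_le_mul_of_nonneg_right h1 hA
      linarith
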